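/- Let $t:\mathbb{N}\to\{-1,1\}$ be the completely multiplicative function with $t_3=1$, $t_p=-1$ for all primes $p\equiv 2\pmod 3$ and $t_p=1$ for all primes $p\equiv 1\pmod 3$, where $\mathbb{N}=\{1,2,3,\dots\}$, and let $T(z)=\sum_{n\ge 1}t_nz^n$ be its generating function. For every complex $z$ with $|z|<1$ this series converges and $$T(z)=\sum_{k=0}^{\infty}\frac{z^{3^k}}{1+z^{3^k}+z^{2\cdot 3^k}}.$$ The function $T(z)$ is transcendental over $\mathbb{C}(z)$: the formal power series $T$ is not algebraic over the field $\mathbb{C}(z)$ of rational functions, and there is no nonzero polynomial $P(z,w)\in\mathbb{C}[z,w]$ with $P(z,T(z))=0$ for all $|z|<1$. Moreover, $T(\alpha)$ is a transcendental number (over $\mathbb{Q}$) for every nonzero algebraic number $\alpha\in\mathbb{C}$ with $|\alpha|<1$. -/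

import Mathlib

open Polynomial PowerSeries LaurentSeries
open scoped RatFunc

/-- The prescribed values on primes: `-1` on primes `p ≡ 2 (mod 3)`, and `1` on the other
primes (that is, on `3` and on the primes `p ≡ 1 (mod 3)`). -/
def signMod3 (p : ℕ) : ℤ := if p % 3 = 2 then -1 else 1

/-- The completely multiplicative function `t` whose values on primes are given by `signMod3`,
i.e. `t n = ∏ signMod3 p` over the prime factors `p` of `n`, counted with multiplicity
(and `t 0 = 0`). -/
def liouvilleMod3 : ℕ →*₀ ℤ where
  toFun n := if n = 0 then 0 else (n.primeFactorsList.map signMod3).prod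
  map_zero' := by simp
  map_one' := by simp
  map_mul' m n := by
    by_cases hm : m = 0
    · simp [hm]
    by_cases hn : n = 0
    · simp [hn]
    simp only [hm, hn, mul_eq_zero, or_self, if_false]
    rw [((Nat.perm_primeFactorsList_mul hm hn).map signMod3).prod_eq, List.map_append,
      List.prod_append]

theorem liouvilleMod3_prime {p : ℕ} (hp : p.Prime) : liouvilleMod3 p = signMod3 p := by
  simp [liouvilleMod3, hp.ne_zero, Nat.primeFactorsList_prime hp]

theorem liouvilleMod3_three : liouvilleMod3 3 = 1 := by
  simp [liouvilleMod3_prime Nat.prime_three, signMod3]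

theorem liouvilleMod3_prime_of_mod_two {p : ℕ} (hp : p.Prime) (h : p % 3 = 2) :
    liouvilleMod3 p = -1 := by
  simp [liouvilleMod3_prime hp, signMod3, h]

theorem liouvilleMod3_prime_of_mod_one {p : ℕ} (hp : p.Prime) (h : p % 3 = 1) :
    liouvilleMod3 p = 1 := by
  simp [liouvilleMod3_prime hp, signMod3, h]

/-- A completely multiplicative function is determined by its values on primes. -/
theorem eq_liouvilleMod3 (t : ℕ →*₀ ℤ) (h3 : t 3 = 1)
    (h2 : ∀ p : ℕ, p.Prime → p % 3 = 2 → t p = -1)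
    (h1 : ∀ p : ℕ, p.Prime → p % 3 = 1 → t p = 1) : t = liouvilleMod3 := by
  refine DFunLike.ext _ _ fun n => ?_
  induction n using Nat.recOnMul with
  | zero => simp
  | one => simp
  | prime p hp =>
    rcases (by omega : p % 3 = 0 ∨ p % 3 = 1 ∨ p % 3 = 2) with h | h | h
    · obtain rfl : 3 = p := (Nat.prime_dvd_prime_iff_eq Nat.prime_three hp).1
        (Nat.dvd_of_mod_eq_zero h)
      rw [h3, liouvilleMod3_three]
    · rw [h1 p hp h, liouvilleMod3_prime_of_mod_one hp h]
    · rw [h2 p hp h, liouvilleMod3_prime_of_mod_two hp h]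
  | mul a b ha hb => rw [map_mul, map_mul, ha, hb]

/-- The generating series `∑ t n * z ^ n` as a formal power series over `ℂ`
(the constant term is `t 0 = 0`). -/
noncomputable def liouvilleMod3Series : ℂ⟦X⟧ :=
  PowerSeries.mk fun n => (liouvilleMod3 n : ℂ)

/-- The generating function `T(z) = ∑ t n * z ^ n` as a function of a complex variable; it is
used only for `‖z‖ < 1`, where the series converges absolutely. -/
noncomputable def liouvilleMod3Gen (z : ℂ) : ℂ :=
  ∑' n : ℕ, (liouvilleMod3 n : ℂ) * z ^ n

/-!
The proof is Mahler's method, made elementary by an explicit form of the functional equation. Write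
`T` for the generating function and `m = 3 ^ k`. Unless `m ∣ n`, the coefficient `t n` depends only
on `n` modulo `m`, and `t (m * q) = t q`. Splitting the series into residue classes modulo `m` gives

  `T z = A z / (1 - z ^ m) + T (z ^ m)`,  `A z = ∑_{n < m} t n * z ^ n`  (`liouvilleMod3Gen_eq`).

For `m = 3` the first term is `z / (1 + z + z ^ 2)`, and iterating gives the closed form
(`hasSum_liouvilleMod3Gen_closed`).

*Transcendence of the function.* Along the points `x k` with `x k ^ 3 ^ k = 1 / 2`, the closed form
makes `T (x k)` grow linearly in `k`, while `1 - x k` decays exponentially. In a relation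
`P(z, T z) = 0` with `P ≠ 0`, divide by the largest possible power of `z - 1`; then the polynomial
`P(1, w)` is nonzero and `P(x k, T (x k)) = P(1, T (x k)) + o(1)`, so `P(1, T (x k)) → 0` although
`T (x k) → ∞`, which is impossible (`exists_evalEval_ne_zero`). The statement about the formal series
follows, since a polynomial relation between formal series is inherited by their sums
(`HasDiscSum.aeval`).

*Transcendence of the values.* Suppose that `α` and `T α` both lie in a number field `K` of degree
`d`. By a dimension count there is a nonzero integer polynomial `P(z, w)`, of degree at most `N` in
each variable, such that `E z = P(z, T z)` vanishes at `0` to order at least `N ^ 2`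
(`exists_bivariate_coeff_eq_zero`). By the transcendence of the function `E ≠ 0`, so
`E (α ^ m) ≠ 0` for large `k`. By the functional equation `(1 - α ^ m) ^ N * E (α ^ m)` is an element
of `K` whose denominator and conjugates are bounded by `G₀ ^ (m * N)`, up to factors independent of
`m`, with `G₀` independent of `m` and `N` (`isIntegral_orbitValue`, `norm_orbitValue_le`). Its norm
is then bounded below (`one_le_norm_mul_pow`), while `E (α ^ m) = O(‖α‖ ^ (m * N ^ 2))`. For `N` large
and `k → ∞` the two estimates contradict each other.
-/

open Filter Topology

/-! ### Arithmetic of the coefficients -/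

theorem liouvilleMod3_three_mul (n : ℕ) : liouvilleMod3 (3 * n) = liouvilleMod3 n := by
  rw [map_mul, liouvilleMod3_three, one_mul]

/-- Away from multiples of `3` the function is the quadratic character modulo `3`. -/
theorem liouvilleMod3_of_not_dvd (n : ℕ) :
    (n % 3 = 1 → liouvilleMod3 n = 1) ∧ (n % 3 = 2 → liouvilleMod3 n = -1) := by
  induction n using Nat.recOnMul with
  | zero => simp
  | one => simp
  | prime p hp =>
    exact ⟨liouvilleMod3_prime_of_mod_one hp, liouvilleMod3_prime_of_mod_two hp⟩
  | mul a b ha hb =>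
    rw [map_mul, Nat.mul_mod]
    have h1 : a % 3 = 0 ∨ a % 3 = 1 ∨ a % 3 = 2 := by omega
    have h2 : b % 3 = 0 ∨ b % 3 = 1 ∨ b % 3 = 2 := by omega
    rcases h1 with h1 | h1 | h1 <;> rcases h2 with h2 | h2 | h2 <;>
      simp [h1, h2, ha, hb]

theorem abs_liouvilleMod3_le (n : ℕ) : |liouvilleMod3 n| ≤ 1 := by
  induction n using Nat.recOnMul with
  | zero => simp
  | one => simp
  | prime p hp => rw [liouvilleMod3_prime hp, signMod3]; split_ifs <;> simp
  | mul a b ha hb => rw [map_mul, abs_mul]; exact mul_le_one₀ ha (abs_nonneg _) hb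

/-- If `3 ^ k` does not divide the index, the coefficient depends only on the index modulo
`3 ^ k`. -/
theorem liouvilleMod3_add_three_pow_mul (k q n : ℕ) (hn : 0 < n) (hk : n < 3 ^ k) :
    liouvilleMod3 (n + 3 ^ k * q) = liouvilleMod3 n := by
  induction k generalizing n with
  | zero => simp at hk; omega
  | succ k ih =>
    have h3 : n + 3 ^ (k + 1) * q = n + 3 * (3 ^ k * q) := by ring
    rcases (by omega : n % 3 = 0 ∨ n % 3 = 1 ∨ n % 3 = 2) with h | h | h
    · obtain ⟨m, rfl⟩ := Nat.dvd_of_mod_eq_zero h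
      rw [h3, ← mul_add, liouvilleMod3_three_mul, liouvilleMod3_three_mul]
      exact ih m (by omega) (by rw [pow_succ] at hk; omega)
    · rw [(liouvilleMod3_of_not_dvd n).1 h, h3, (liouvilleMod3_of_not_dvd _).1 (by omega)]
    · rw [(liouvilleMod3_of_not_dvd n).2 h, h3, (liouvilleMod3_of_not_dvd _).2 (by omega)]

theorem liouvilleMod3_three_pow_mul (k q : ℕ) :
    liouvilleMod3 (3 ^ k * q) = liouvilleMod3 q := by
  rw [map_mul, map_pow, liouvilleMod3_three, one_pow, one_mul]

/-! ### The functional equation and the closed form -/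

theorem norm_liouvilleMod3_le (n : ℕ) : ‖(liouvilleMod3 n : ℂ)‖ ≤ 1 := by
  rw [Complex.norm_intCast]; exact_mod_cast abs_liouvilleMod3_le n

theorem summable_norm_liouvilleMod3 {z : ℂ} (hz : ‖z‖ < 1) :
    Summable fun n : ℕ => ‖(liouvilleMod3 n : ℂ) * z ^ n‖ := by
  refine Summable.of_nonneg_of_le (fun _ => norm_nonneg _) (fun n => ?_)
    (summable_geometric_of_lt_one (norm_nonneg z) hz)
  rw [norm_mul, norm_pow]
  exact mul_le_of_le_one_left (by positivity) (norm_liouvilleMod3_le n)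

/-- The polynomial `∑_{n < m} t n * z ^ n`, evaluated in a commutative ring. -/
def liouvilleMod3Trunc {R : Type*} [CommRing R] (m : ℕ) (z : R) : R :=
  ∑ n ∈ Finset.range m, (liouvilleMod3 n : R) * z ^ n

theorem one_sub_ne_zero_of_norm_lt {z : ℂ} (hz : ‖z‖ < 1) : 1 - z ≠ 0 := by
  intro h
  rw [← sub_eq_zero.1 h, norm_one] at hz
  exact lt_irrefl _ hz

theorem norm_pow_three_pow_lt {z : ℂ} (hz : ‖z‖ < 1) (k : ℕ) : ‖z ^ 3 ^ k‖ < 1 := by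
  rw [norm_pow]; exact pow_lt_one₀ (norm_nonneg _) hz (by positivity)

/-- The iterated functional equation: splitting the series by residues modulo `3 ^ k`, each
nonzero class is a geometric series and the zero class is `T (z ^ 3 ^ k)`. -/
theorem liouvilleMod3Gen_eq (k : ℕ) {z : ℂ} (hz : ‖z‖ < 1) :
    liouvilleMod3Gen z =
      liouvilleMod3Trunc (3 ^ k) z / (1 - z ^ 3 ^ k) + liouvilleMod3Gen (z ^ 3 ^ k) := by
  have hm := norm_pow_three_pow_lt hz k
  have key := Nat.sumByResidueClasses (summable_norm_liouvilleMod3 hz).of_norm (3 ^ k)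
  have hR : ∀ f : ℕ → ℂ, ∑ j : ZMod (3 ^ k), f j.val = ∑ n ∈ Finset.range (3 ^ k), f n := by
    intro f
    refine Finset.sum_bij (fun j _ => j.val) (fun j _ => Finset.mem_range.2 (ZMod.val_lt j))
      (fun a _ b _ h => ZMod.val_injective _ h)
      (fun n hn => ⟨(n : ZMod (3 ^ k)), Finset.mem_univ _,
        ZMod.val_cast_of_lt (Finset.mem_range.1 hn)⟩) (fun _ _ => rfl)
  rw [hR fun n => ∑' q : ℕ, (liouvilleMod3 (n + 3 ^ k * q) : ℂ) * z ^ (n + 3 ^ k * q)] at key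
  rw [liouvilleMod3Gen, key, liouvilleMod3Trunc]
  obtain ⟨M, hM⟩ : ∃ M, 3 ^ k = M + 1 := Nat.exists_eq_succ_of_ne_zero (by positivity)
  rw [hM, Finset.sum_range_succ', Finset.sum_range_succ', ← hM]
  simp only [map_zero, Int.cast_zero, zero_mul, add_zero, zero_add, Finset.sum_div]
  congr 1
  · refine Finset.sum_congr rfl fun n hn => ?_
    have hlt : n + 1 < 3 ^ k := by rw [hM]; have := Finset.mem_range.1 hn; omega
    simp_rw [liouvilleMod3_add_three_pow_mul k _ (n + 1) (Nat.succ_pos n) hlt, pow_add z,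
      pow_mul z, ← mul_assoc]
    rw [tsum_mul_left, tsum_geometric_of_norm_lt_one hm, div_eq_mul_inv]
  · simp_rw [liouvilleMod3_three_pow_mul, pow_mul z, liouvilleMod3Gen]

theorem liouvilleMod3Trunc_three {R : Type*} [CommRing R] (z : R) :
    liouvilleMod3Trunc 3 z = z * (1 - z) := by
  rw [liouvilleMod3Trunc]
  simp [Finset.sum_range_succ, (liouvilleMod3_of_not_dvd 2).2]
  ring

theorem one_add_add_sq_ne_zero {z : ℂ} (hz : ‖z‖ < 1) : 1 + z + z ^ 2 ≠ 0 := by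
  intro h
  have h3 : 1 - z ^ 3 ^ 1 ≠ 0 := one_sub_ne_zero_of_norm_lt (norm_pow_three_pow_lt hz 1)
  apply h3
  linear_combination (1 - z) * h

theorem liouvilleMod3Gen_sub {z : ℂ} (hz : ‖z‖ < 1) :
    liouvilleMod3Gen z = z / (1 + z + z ^ 2) + liouvilleMod3Gen (z ^ 3) := by
  have h := liouvilleMod3Gen_eq 1 hz
  rw [pow_one] at h
  rw [h, liouvilleMod3Trunc_three]
  congr 1
  have h1 := one_sub_ne_zero_of_norm_lt hz
  have h2 := one_add_add_sq_ne_zero hz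
  have h3 : 1 - z ^ 3 = (1 - z) * (1 + z + z ^ 2) := by ring
  rw [h3]
  field_simp

theorem norm_liouvilleMod3Gen_le {z : ℂ} (hz : ‖z‖ < 1) :
    ‖liouvilleMod3Gen z‖ ≤ ‖z‖ / (1 - ‖z‖) := by
  have h0 : liouvilleMod3Gen z = ∑' n : ℕ, (liouvilleMod3 (n + 1) : ℂ) * z ^ (n + 1) := by
    rw [liouvilleMod3Gen, (summable_norm_liouvilleMod3 hz).of_norm.tsum_eq_zero_add]
    simp
  rw [h0, div_eq_mul_inv]
  refine tsum_of_norm_bounded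
    ((hasSum_geometric_of_lt_one (norm_nonneg z) hz).mul_left ‖z‖) fun n => ?_
  rw [norm_mul, norm_pow, pow_succ']
  exact mul_le_of_le_one_left (by positivity) (norm_liouvilleMod3_le _)

theorem tendsto_three_pow_atTop : Tendsto (fun k : ℕ => 3 ^ k) atTop atTop :=
  tendsto_pow_atTop_atTop_of_one_lt (by norm_num)

theorem tendsto_liouvilleMod3Gen_pow {z : ℂ} (hz : ‖z‖ < 1) :
    Tendsto (fun k : ℕ => liouvilleMod3Gen (z ^ 3 ^ k)) atTop (𝓝 0) := by
  have h1 : Tendsto (fun k : ℕ => ‖z ^ 3 ^ k‖) atTop (𝓝 0) := by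
    simp_rw [norm_pow]
    exact (tendsto_pow_atTop_nhds_zero_of_lt_one (norm_nonneg z) hz).comp tendsto_three_pow_atTop
  have h2 : Tendsto (fun k : ℕ => ‖z ^ 3 ^ k‖ / (1 - ‖z ^ 3 ^ k‖)) atTop (𝓝 (0 / (1 - 0))) :=
    h1.div (h1.const_sub 1) (by norm_num)
  rw [zero_div] at h2
  exact squeeze_zero_norm (fun k => norm_liouvilleMod3Gen_le (norm_pow_three_pow_lt hz k)) h2

theorem liouvilleMod3Gen_eq_sum (k : ℕ) {z : ℂ} (hz : ‖z‖ < 1) :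
    liouvilleMod3Gen z =
      ∑ j ∈ Finset.range k, z ^ 3 ^ j / (1 + z ^ 3 ^ j + z ^ (2 * 3 ^ j)) +
        liouvilleMod3Gen (z ^ 3 ^ k) := by
  induction k with
  | zero => simp
  | succ k ih =>
    rw [ih, Finset.sum_range_succ, liouvilleMod3Gen_sub (norm_pow_three_pow_lt hz k)]
    simp only [← pow_mul, ← pow_succ, mul_comm 2, add_assoc]

theorem hasSum_liouvilleMod3Gen_closed {z : ℂ} (hz : ‖z‖ < 1) :
    HasSum (fun k : ℕ => z ^ 3 ^ k / (1 + z ^ 3 ^ k + z ^ (2 * 3 ^ k)))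
      (liouvilleMod3Gen z) := by
  have hs : Summable fun k : ℕ => ‖z ^ 3 ^ k / (1 + z ^ 3 ^ k + z ^ (2 * 3 ^ k))‖ := by
    refine Summable.of_nonneg_of_le (fun _ => norm_nonneg _) (fun k => ?_)
      ((summable_geometric_of_lt_one (norm_nonneg z) hz).mul_left (2 / (1 - ‖z‖)))
    have hw := norm_pow_three_pow_lt hz k
    have h1 := one_sub_ne_zero_of_norm_lt hw
    have h2 := one_add_add_sq_ne_zero hw
    -- `w / (1 + w + w ^ 2) = w * (1 - w) / (1 - w ^ 3)` with `w = z ^ 3 ^ k`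
    have h3 : z ^ 3 ^ k / (1 + z ^ 3 ^ k + z ^ (2 * 3 ^ k)) =
        z ^ 3 ^ k * (1 - z ^ 3 ^ k) / (1 - z ^ 3 ^ (k + 1)) := by
      have h4 : 1 - z ^ 3 ^ (k + 1) = (1 - z ^ 3 ^ k) * (1 + z ^ 3 ^ k + (z ^ 3 ^ k) ^ 2) := by
        rw [pow_succ, pow_mul]; ring
      rw [h4, mul_comm 2, pow_mul]
      field_simp
    have hk : ‖z ^ 3 ^ k‖ ≤ ‖z‖ ^ k := by
      rw [norm_pow]
      exact pow_le_pow_of_le_one (norm_nonneg z) hz.le (Nat.lt_pow_self (by norm_num)).le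
    have hnum : ‖1 - z ^ 3 ^ k‖ ≤ 2 := by
      refine (norm_sub_le _ _).trans ?_
      rw [norm_one]; linarith
    have hden : 1 - ‖z‖ ≤ ‖1 - z ^ 3 ^ (k + 1)‖ := by
      have h5 := norm_sub_norm_le (1 : ℂ) (z ^ 3 ^ (k + 1))
      have h6 : ‖z ^ 3 ^ (k + 1)‖ ≤ ‖z‖ := by
        rw [norm_pow]
        exact pow_le_of_le_one (norm_nonneg z) hz.le (by positivity)
      rw [norm_one] at h5; linarith
    have hpos : 0 < 1 - ‖z‖ := by linarith
    rw [h3, norm_div, norm_mul]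
    calc ‖z ^ 3 ^ k‖ * ‖1 - z ^ 3 ^ k‖ / ‖1 - z ^ 3 ^ (k + 1)‖
        ≤ ‖z‖ ^ k * 2 / (1 - ‖z‖) := by gcongr
      _ = _ := by ring
  refine (hs.of_norm.hasSum_iff_tendsto_nat).2 ?_
  have h := (tendsto_liouvilleMod3Gen_pow hz).const_sub (liouvilleMod3Gen z)
  rw [sub_zero] at h
  refine h.congr fun k => ?_
  rw [sub_eq_iff_eq_add]
  exact liouvilleMod3Gen_eq_sum k hz

/-! ### Formal power series and their sums on the unit disc -/

/-- The formal power series `f` converges absolutely on the open unit disc, with sum `F`. -/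
def HasDiscSum (f : ℂ⟦X⟧) (F : ℂ → ℂ) : Prop :=
  ∀ z : ℂ, ‖z‖ < 1 → Summable (fun n => ‖PowerSeries.coeff n f * z ^ n‖) ∧
    HasSum (fun n => PowerSeries.coeff n f * z ^ n) (F z)

namespace HasDiscSum

variable {f g : ℂ⟦X⟧} {F G : ℂ → ℂ}

theorem add (hf : HasDiscSum f F) (hg : HasDiscSum g G) :
    HasDiscSum (f + g) (fun z => F z + G z) := by
  intro z hz
  obtain ⟨hf1, hf2⟩ := hf z hz
  obtain ⟨hg1, hg2⟩ := hg z hz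
  simp only [map_add, add_mul]
  exact ⟨Summable.of_nonneg_of_le (fun _ => norm_nonneg _) (fun _ => norm_add_le _ _)
    (hf1.add hg1), hf2.add hg2⟩

theorem mul (hf : HasDiscSum f F) (hg : HasDiscSum g G) :
    HasDiscSum (f * g) (fun z => F z * G z) := by
  intro z hz
  obtain ⟨hf1, hf2⟩ := hf z hz
  obtain ⟨hg1, hg2⟩ := hg z hz
  have key : ∀ n, PowerSeries.coeff n (f * g) * z ^ n =
      ∑ kl ∈ Finset.HasAntidiagonal.antidiagonal n,
        (PowerSeries.coeff kl.1 f * z ^ kl.1) * (PowerSeries.coeff kl.2 g * z ^ kl.2) := by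
    intro n
    rw [PowerSeries.coeff_mul, Finset.sum_mul]
    refine Finset.sum_congr rfl fun kl hkl => ?_
    rw [← Finset.HasAntidiagonal.mem_antidiagonal.1 hkl, pow_add]
    ring
  have hs := summable_norm_sum_mul_antidiagonal_of_summable_norm hf1 hg1
  simp only [key]
  refine ⟨hs, ?_⟩
  have h := tsum_mul_tsum_eq_tsum_sum_antidiagonal_of_summable_norm hf1 hg1
  rw [hf2.tsum_eq, hg2.tsum_eq] at h
  rw [h]
  exact hs.of_norm.hasSum

theorem coe_polynomial (p : ℂ[X]) : HasDiscSum (p : ℂ⟦X⟧) (fun z => p.eval z) := by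
  intro z _
  have hsupp : ∀ n ∉ p.support, p.coeff n * z ^ n = 0 := fun n hn => by
    rw [Polynomial.notMem_support_iff.1 hn, zero_mul]
  simp only [Polynomial.coeff_coe]
  refine ⟨summable_of_ne_finset_zero (s := p.support) fun n hn => by rw [hsupp n hn, norm_zero],
    ?_⟩
  rw [Polynomial.eval_eq_sum, Polynomial.sum]
  exact hasSum_sum_of_ne_finset_zero hsupp

theorem pow (hf : HasDiscSum f F) (n : ℕ) : HasDiscSum (f ^ n) (fun z => F z ^ n) := by
  induction n with
  | zero => simpa using coe_polynomial 1
  | succ n ih => simpa only [pow_succ] using ih.mul hf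

/-- A polynomial expression in `z` and `f` is the series of the same expression in `z` and the
sum of `f`. -/
theorem aeval (hf : HasDiscSum f F) (P : ℂ[X][X]) :
    HasDiscSum (Polynomial.aeval f P) (fun z => P.evalEval z (F z)) := by
  induction P using Polynomial.induction_on' with
  | add p q hp hq => simpa using hp.add hq
  | monomial n a =>
    have h := (coe_polynomial a).mul (hf.pow n)
    have h1 : Polynomial.aeval f (Polynomial.monomial n a) = (a : ℂ⟦X⟧) * f ^ n := by
      rw [Polynomial.aeval_monomial, PowerSeries.algebraMap_apply']
      simp
    rw [h1]
    simpa [Polynomial.evalEval, ← Polynomial.C_mul_X_pow_eq_monomial] using h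

theorem eq_zero_of_zero (hF : HasDiscSum 0 F) {z : ℂ} (hz : ‖z‖ < 1) : F z = 0 := by
  have h := (hF z hz).2
  simp only [map_zero, zero_mul] at h
  exact h.unique hasSum_zero

theorem exists_bound (hf : HasDiscSum f F) {r : ℝ} (h0 : 0 ≤ r) (h1 : r < 1) :
    ∃ C : ℝ, 0 ≤ C ∧ ∀ z : ℂ, ‖z‖ ≤ r → ‖F z‖ ≤ C := by
  have hr : ‖(r : ℂ)‖ = r := by rw [Complex.norm_real, Real.norm_of_nonneg h0]
  have hs := (hf r (by rwa [hr])).1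
  refine ⟨∑' n, ‖PowerSeries.coeff n f * (r : ℂ) ^ n‖, tsum_nonneg fun _ => norm_nonneg _,
    fun z hz => ?_⟩
  rw [← (hf z (hz.trans_lt h1)).2.tsum_eq]
  refine tsum_of_norm_bounded hs.hasSum fun n => ?_
  rw [norm_mul, norm_mul, norm_pow, norm_pow, hr]
  gcongr

/-- A series whose first `k` coefficients vanish is `z ^ k` times another series. -/
theorem exists_shift (hf : HasDiscSum f F) (k : ℕ) (hk : ∀ n < k, PowerSeries.coeff n f = 0) :
    ∃ G, HasDiscSum (PowerSeries.mk fun n => PowerSeries.coeff (n + k) f) G ∧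
      ∀ z : ℂ, ‖z‖ < 1 → F z = z ^ k * G z := by
  have hz0 : ∀ z : ℂ, ∑ n ∈ Finset.range k, PowerSeries.coeff n f * z ^ n = 0 := fun z =>
    Finset.sum_eq_zero fun n hn => by rw [hk n (Finset.mem_range.1 hn), zero_mul]
  have hS : ∀ z : ℂ, ‖z‖ < 1 →
      Summable fun n => ‖PowerSeries.coeff (n + k) f * z ^ n‖ := by
    intro z hz
    rcases eq_or_ne z 0 with rfl | hz'
    · refine summable_of_ne_finset_zero (s := {0}) fun n hn => ?_
      rw [zero_pow (by simpa using hn), mul_zero, norm_zero]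
    · have h := ((summable_nat_add_iff k).2 (hf z hz).1).mul_left (‖z ^ k‖⁻¹)
      refine h.congr fun n => ?_
      have : ‖z ^ k‖ ≠ 0 := norm_ne_zero_iff.2 (pow_ne_zero _ hz')
      rw [pow_add, ← mul_assoc, norm_mul _ (z ^ k)]
      field_simp
  refine ⟨fun z => ∑' n, PowerSeries.coeff (n + k) f * z ^ n, fun z hz => ?_, fun z hz => ?_⟩
  · simp only [PowerSeries.coeff_mk]
    exact ⟨hS z hz, (hS z hz).of_norm.hasSum⟩
  · rw [← (hf z hz).2.tsum_eq, ← (hf z hz).1.of_norm.sum_add_tsum_nat_add k, hz0, zero_add,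
      ← tsum_mul_left]
    refine tsum_congr fun n => ?_
    rw [pow_add]; ring

/-- The sum of a nonzero power series has no zeros in a punctured neighbourhood of `0`. -/
theorem exists_forall_ne_zero (hf : HasDiscSum f F) (h0 : f ≠ 0) :
    ∃ ε : ℝ, 0 < ε ∧ ∀ z : ℂ, z ≠ 0 → ‖z‖ < ε → F z ≠ 0 := by
  classical
  have hex : ∃ n, PowerSeries.coeff n f ≠ 0 := by
    by_contra! h
    exact h0 (PowerSeries.ext fun n => by simpa using h n)
  obtain ⟨G, hG, hFG⟩ := hf.exists_shift (Nat.find hex) fun n hn =>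
    not_not.1 (Nat.find_min hex hn)
  set a := PowerSeries.coeff (Nat.find hex) f with ha
  have ha0 : a ≠ 0 := Nat.find_spec hex
  -- `G = a + z * H` with `a ≠ 0` and `H` bounded near the origin
  have hGa : HasDiscSum (PowerSeries.mk (fun n => PowerSeries.coeff (n + Nat.find hex) f) +
      ((Polynomial.C (-a) : ℂ[X]) : ℂ⟦X⟧)) (fun z => G z + (Polynomial.C (-a)).eval z) :=
    hG.add (coe_polynomial _)
  obtain ⟨H, hH, hGH⟩ := hGa.exists_shift 1 fun n hn => by
    obtain rfl : n = 0 := by omega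
    simp [ha]
  obtain ⟨C, hC0, hC⟩ := hH.exists_bound (r := 1 / 2) (by norm_num) (by norm_num)
  have hapos : 0 < ‖a‖ := norm_pos_iff.2 ha0
  refine ⟨min (1 / 2) (‖a‖ / (C + 1)), by positivity, fun z hz hlt => ?_⟩
  have hz1 : ‖z‖ < 1 / 2 := hlt.trans_le (min_le_left _ _)
  have hz2 : ‖z‖ * (C + 1) < ‖a‖ :=
    (lt_div_iff₀ (by positivity)).1 (hlt.trans_le (min_le_right _ _))
  rw [hFG z (by linarith)]
  refine mul_ne_zero (pow_ne_zero _ hz) fun hG0 => ?_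
  have h := hGH z (by linarith)
  rw [hG0, Polynomial.eval_C, zero_add, pow_one] at h
  have h' : ‖a‖ = ‖z‖ * ‖H z‖ := by rw [← norm_mul, ← h, norm_neg]
  have := mul_le_mul_of_nonneg_left (hC z hz1.le) (norm_nonneg z)
  have := norm_nonneg z
  linarith

end HasDiscSum

theorem hasDiscSum_liouvilleMod3 : HasDiscSum liouvilleMod3Series liouvilleMod3Gen := by
  intro z hz
  have h := summable_norm_liouvilleMod3 hz
  simp only [liouvilleMod3Series, PowerSeries.coeff_mk]
  exact ⟨h, h.of_norm.hasSum⟩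

/-! ### Transcendence over the rational functions -/

/-- If `x k → a` while `w k → ∞` more slowly than any positive power of `1 / (x k - a)`, then no
nonzero polynomial vanishes at all points `(x k, w k)`. -/
theorem exists_evalEval_ne_zero {P : ℂ[X][X]} (hP : P ≠ 0) {a : ℂ} {x w : ℕ → ℂ}
    (hxa : ∀ k, x k ≠ a) (hx : Tendsto x atTop (𝓝 a))
    (hw : Tendsto (fun k => ‖w k‖) atTop atTop)
    (hxw : ∀ j : ℕ, Tendsto (fun k => (x k - a) * w k ^ j) atTop (𝓝 0)) :
    ∃ k, P.evalEval (x k) (w k) ≠ 0 := by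
  -- divide by the largest power of `z - a`, so that the coefficients do not all vanish at `a`
  have hfin : FiniteMultiplicity (Polynomial.C (Polynomial.X - Polynomial.C a) : ℂ[X][X]) P := by
    refine FiniteMultiplicity.of_prime_left ?_ hP
    rw [Polynomial.prime_C_iff]
    exact Polynomial.prime_X_sub_C a
  obtain ⟨Q, hPQ, hQ⟩ := hfin.exists_eq_pow_mul_and_not_dvd
  set q : ℂ[X] := Q.map (Polynomial.evalRingHom a) with hq
  have hq0 : q ≠ 0 := by
    intro h
    refine hQ ((Polynomial.C_dvd_iff_dvd_coeff _ _).2 fun i => ?_)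
    rw [Polynomial.dvd_iff_isRoot, Polynomial.IsRoot.def]
    have := congrArg (fun r => Polynomial.coeff r i) h
    simpa [hq, Polynomial.coeff_map] using this
  obtain ⟨S, hS⟩ : (Polynomial.C (Polynomial.X - Polynomial.C a) : ℂ[X][X]) ∣
      Q - q.map Polynomial.C := by
    refine (Polynomial.C_dvd_iff_dvd_coeff _ _).2 fun i => ?_
    rw [Polynomial.dvd_iff_isRoot, Polynomial.IsRoot.def]
    simp [hq, Polynomial.coeff_map]
  by_contra! hall
  have hQ0 : ∀ k, Q.evalEval (x k) (w k) = 0 := by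
    intro k
    have h := hall k
    rw [hPQ, Polynomial.evalEval_mul, Polynomial.evalEval_pow, Polynomial.evalEval_C,
      mul_eq_zero] at h
    refine h.resolve_left (pow_ne_zero _ ?_)
    simpa using sub_ne_zero.2 (hxa k)
  have hqS : ∀ k, q.eval (w k) = -((x k - a) * S.evalEval (x k) (w k)) := by
    intro k
    have h := congrArg (Polynomial.evalEval (x k) (w k)) hS
    rw [Polynomial.evalEval_sub, hQ0, Polynomial.evalEval_mul, Polynomial.evalEval_C,
      Polynomial.evalEval_map_C] at h
    simp only [Polynomial.eval_sub, Polynomial.eval_X, Polynomial.eval_C] at h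
    rw [← h]; ring
  have hlim : ∀ R : ℂ[X][X],
      Tendsto (fun k => (x k - a) * R.evalEval (x k) (w k)) atTop (𝓝 0) := by
    intro R
    induction R using Polynomial.induction_on' with
    | add p r hp hr => simpa [mul_add] using hp.add hr
    | monomial n c =>
      have h := ((c.continuous.tendsto a).comp hx).mul (hxw n)
      rw [mul_zero] at h
      refine h.congr fun k => ?_
      simp [Polynomial.evalEval, ← Polynomial.C_mul_X_pow_eq_monomial]
      ring
  have hq_lim : Tendsto (fun k => ‖q.eval (w k)‖) atTop (𝓝 0) := by
    simp_rw [hqS]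
    simpa using (hlim S).neg.norm
  rcases lt_or_ge 0 q.degree with hdeg | hdeg
  · exact not_tendsto_nhds_of_tendsto_atTop (q.tendsto_norm_atTop hdeg hw) 0 hq_lim
  · rw [Polynomial.eq_C_of_degree_le_zero hdeg] at hq_lim hq0
    simp only [Polynomial.eval_C] at hq_lim
    refine hq0 ?_
    rw [norm_eq_zero.1 (tendsto_nhds_unique tendsto_const_nhds hq_lim), Polynomial.C_0]

/-- The `3 ^ k`-th root of `1 / 2`: a sequence tending to `1` along which the generating function
grows linearly in `k`. -/
noncomputable def halfRoot (k : ℕ) : ℝ := (1 / 2 : ℝ) ^ ((3 : ℝ) ^ k)⁻¹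

theorem halfRoot_zero : halfRoot 0 = 1 / 2 := by simp [halfRoot]

theorem halfRoot_succ_pow (k : ℕ) : halfRoot (k + 1) ^ 3 = halfRoot k := by
  rw [halfRoot, halfRoot, ← Real.rpow_natCast, ← Real.rpow_mul (by norm_num)]
  congr 1
  rw [pow_succ]
  push_cast
  field_simp

theorem halfRoot_lt_one (k : ℕ) : halfRoot k < 1 :=
  Real.rpow_lt_one (by norm_num) (by norm_num) (by positivity)

theorem half_le_halfRoot (k : ℕ) : 1 / 2 ≤ halfRoot k := by
  rw [halfRoot]
  conv_lhs => rw [← Real.rpow_one (1 / 2)]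
  exact Real.rpow_le_rpow_of_exponent_ge (by norm_num) (by norm_num)
    (inv_le_one_of_one_le₀ (one_le_pow₀ (by norm_num)))

theorem one_sub_halfRoot_le (k : ℕ) : 1 - halfRoot k ≤ (4 / 7) ^ k := by
  induction k with
  | zero => rw [halfRoot_zero]; norm_num
  | succ k ih =>
    have h1 := half_le_halfRoot (k + 1)
    have h2 := halfRoot_lt_one (k + 1)
    rw [← halfRoot_succ_pow] at ih
    have h3 : 7 / 4 * (1 - halfRoot (k + 1)) ≤ 1 - halfRoot (k + 1) ^ 3 := by
      nlinarith [mul_nonneg (sub_nonneg.2 h2.le)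
        (by nlinarith : 0 ≤ 1 + halfRoot (k + 1) + halfRoot (k + 1) ^ 2 - 7 / 4)]
    rw [pow_succ]
    linarith

theorem norm_halfRoot_lt (k : ℕ) : ‖(halfRoot k : ℂ)‖ < 1 := by
  rw [Complex.norm_real, Real.norm_of_nonneg (by linarith [half_le_halfRoot k])]
  exact halfRoot_lt_one k

theorem tendsto_halfRoot : Tendsto (fun k => (halfRoot k : ℂ)) atTop (𝓝 1) := by
  have h : Tendsto (fun k => 1 - halfRoot k) atTop (𝓝 0) :=
    squeeze_zero (fun k => by linarith [halfRoot_lt_one k]) one_sub_halfRoot_le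
      (tendsto_pow_atTop_nhds_zero_of_lt_one (by norm_num) (by norm_num))
  have h' : Tendsto halfRoot atTop (𝓝 1) := by simpa using h.const_sub 1
  exact_mod_cast (Complex.continuous_ofReal.tendsto 1).comp h'

/-- Each of the `k` applications of the functional equation between `halfRoot k` and `1 / 2` adds a
term between `2 / 7`, the value of `y / (1 + y + y ^ 2)` at `1 / 2`, and `1`. -/
theorem liouvilleMod3Gen_halfRoot (k : ℕ) :
    ∃ u : ℝ, liouvilleMod3Gen (halfRoot k) = liouvilleMod3Gen (1 / 2) + u ∧
      2 / 7 * (k : ℝ) ≤ u ∧ u ≤ k := by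
  induction k with
  | zero => exact ⟨0, by rw [halfRoot_zero]; simp⟩
  | succ k ih =>
    obtain ⟨u, hu, h1, h2⟩ := ih
    have hlt := halfRoot_lt_one (k + 1)
    have hge := half_le_halfRoot (k + 1)
    set y := halfRoot (k + 1) with hy
    have hpos : 0 < 1 + y + y ^ 2 := by positivity
    refine ⟨u + y / (1 + y + y ^ 2), ?_, ?_, ?_⟩
    · rw [liouvilleMod3Gen_sub (norm_halfRoot_lt (k + 1))]
      have h3 : (y : ℂ) ^ 3 = (halfRoot k : ℂ) := by
        rw [← halfRoot_succ_pow]; push_cast; rfl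
      rw [← hy, h3, hu]
      push_cast
      ring
    · have : 2 / 7 ≤ y / (1 + y + y ^ 2) := by
        rw [le_div_iff₀ hpos]; nlinarith
      push_cast
      linarith
    · have : y / (1 + y + y ^ 2) ≤ 1 := by
        rw [div_le_one hpos]; nlinarith
      push_cast
      linarith

/-- The generating function satisfies no nonzero polynomial relation on the unit disc: near `1`
it grows like a logarithm. -/
theorem exists_evalEval_liouvilleMod3Gen_ne_zero {P : ℂ[X][X]} (hP : P ≠ 0) :
    ∃ z : ℂ, ‖z‖ < 1 ∧ P.evalEval z (liouvilleMod3Gen z) ≠ 0 := by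
  choose u hu hu1 hu2 using liouvilleMod3Gen_halfRoot
  set c := ‖liouvilleMod3Gen (1 / 2)‖ with hc
  have hnat : Tendsto (fun k : ℕ => (k : ℝ)) atTop atTop := tendsto_natCast_atTop_atTop
  have hlow : ∀ k : ℕ, 2 / 7 * (k : ℝ) - c ≤ ‖liouvilleMod3Gen (halfRoot k)‖ := by
    intro k
    have h := norm_sub_norm_le (u k : ℂ) (-liouvilleMod3Gen (1 / 2))
    rw [norm_neg, sub_neg_eq_add, add_comm, ← hu k, Complex.norm_real] at h
    have := le_abs_self (u k)
    rw [Real.norm_eq_abs] at h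
    linarith [hu1 k]
  have hup : ∀ k : ℕ, 1 ≤ k → ‖liouvilleMod3Gen (halfRoot k)‖ ≤ (c + 1) * k := by
    intro k hk
    have hk' : (1 : ℝ) ≤ k := by exact_mod_cast hk
    have hc0 : 0 ≤ c := norm_nonneg _
    have h0 : 0 ≤ u k := (by positivity : (0 : ℝ) ≤ 2 / 7 * k).trans (hu1 k)
    rw [hu k]
    refine (norm_add_le _ _).trans ?_
    rw [Complex.norm_real, Real.norm_of_nonneg h0]
    nlinarith [hu2 k]
  have hw : Tendsto (fun k => ‖liouvilleMod3Gen (halfRoot k)‖) atTop atTop := by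
    refine tendsto_atTop_mono hlow ?_
    exact tendsto_atTop_add_const_right _ _ (hnat.const_mul_atTop (by norm_num))
  have hxw : ∀ j : ℕ, Tendsto (fun k => ((halfRoot k : ℂ) - 1) * liouvilleMod3Gen (halfRoot k) ^ j)
      atTop (𝓝 0) := by
    intro j
    have h := (tendsto_pow_const_mul_const_pow_of_abs_lt_one j
      (r := (4 / 7 : ℝ)) (by rw [abs_of_pos] <;> norm_num)).const_mul ((c + 1) ^ j)
    rw [mul_zero] at h
    refine squeeze_zero_norm' ?_ h
    filter_upwards [eventually_ge_atTop 1] with k hk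
    have h1 : ‖(halfRoot k : ℂ) - 1‖ ≤ (4 / 7) ^ k := by
      rw [norm_sub_rev, ← Complex.ofReal_one, ← Complex.ofReal_sub, Complex.norm_real,
        Real.norm_of_nonneg (by linarith [halfRoot_lt_one k])]
      exact one_sub_halfRoot_le k
    rw [norm_mul, norm_pow]
    calc _ ≤ (4 / 7) ^ k * ((c + 1) * k) ^ j := by gcongr; exact hup k hk
      _ = _ := by rw [mul_pow]; ring
  obtain ⟨k, hk⟩ := exists_evalEval_ne_zero hP
    (fun k h => (halfRoot_lt_one k).ne (by exact_mod_cast h)) tendsto_halfRoot hw hxw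
  exact ⟨_, norm_halfRoot_lt k, hk⟩

/-- A nonzero polynomial expression in `z` and the formal series does not vanish. -/
theorem aeval_liouvilleMod3Series_ne_zero {P : ℂ[X][X]} (hP : P ≠ 0) :
    Polynomial.aeval liouvilleMod3Series P ≠ 0 := by
  intro h
  obtain ⟨z, hz, hne⟩ := exists_evalEval_liouvilleMod3Gen_ne_zero hP
  have hs := hasDiscSum_liouvilleMod3.aeval P
  rw [h] at hs
  exact hne (hs.eq_zero_of_zero hz)

theorem transcendental_liouvilleMod3Series :
    Transcendental (RatFunc ℂ) (A := LaurentSeries ℂ) (liouvilleMod3Series : LaurentSeries ℂ) := by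
  have : IsScalarTower ℂ[X] ℂ⟦X⟧ (LaurentSeries ℂ) := by
    refine IsScalarTower.of_algebraMap_eq fun p => ?_
    rw [PowerSeries.algebraMap_apply', algebraMap_hahnSeries_apply ℤ]
    simp
  intro h
  rw [← IsFractionRing.isAlgebraic_iff ℂ[X], ← LaurentSeries.coe_algebraMap,
    isAlgebraic_algebraMap_iff (IsFractionRing.injective ℂ⟦X⟧ (LaurentSeries ℂ))] at h
  obtain ⟨P, hP, hP0⟩ := h
  exact aeval_liouvilleMod3Series_ne_zero hP hP0

/-! ### A Liouville inequality -/

/-- Let `ξ ≠ 0` lie in a number field, with denominator `D` and all conjugates bounded by `B`. As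
the norm of `D * ξ` is a nonzero integer, no conjugate of `ξ` can be too small. -/
theorem one_le_norm_mul_pow {K : Type*} [Field K] [NumberField K] (φ : K →ₐ[ℚ] ℂ) {ξ : K}
    (hξ : ξ ≠ 0) {D : ℤ} (hD : D ≠ 0) (hint : IsIntegral ℤ ((D : K) * ξ)) {B : ℝ} (hB : 1 ≤ B)
    (hσ : ∀ σ : K →ₐ[ℚ] ℂ, ‖σ ξ‖ ≤ B) :
    1 ≤ ‖φ ξ‖ * (|(D : ℝ)| * B) ^ Fintype.card (K →ₐ[ℚ] ℂ) := by
  classical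
  have hD1 : 1 ≤ |(D : ℝ)| := by exact_mod_cast Int.one_le_abs hD
  have hη : (D : K) * ξ ≠ 0 := mul_ne_zero (by exact_mod_cast hD) hξ
  obtain ⟨a, ha⟩ := IsIntegrallyClosed.isIntegral_iff.1 (Algebra.isIntegral_norm ℚ hint)
  have ha0 : a ≠ 0 := by
    rintro rfl
    rw [map_zero, eq_comm, Algebra.norm_eq_zero_iff] at ha
    exact hη ha
  have hprod : ∏ σ : K →ₐ[ℚ] ℂ, ‖σ ((D : K) * ξ)‖ = |(a : ℝ)| := by
    rw [← norm_prod, ← Algebra.norm_eq_prod_embeddings ℚ ℂ, ← ha]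
    simp
  have hterm : ∀ σ : K →ₐ[ℚ] ℂ, ‖σ ((D : K) * ξ)‖ = |(D : ℝ)| * ‖σ ξ‖ := by
    intro σ
    rw [map_mul, map_intCast, norm_mul, Complex.norm_intCast]
  have hrest : ∏ σ ∈ Finset.univ.erase φ, ‖σ ((D : K) * ξ)‖ ≤
      (|(D : ℝ)| * B) ^ (Fintype.card (K →ₐ[ℚ] ℂ) - 1) := by
    rw [← Finset.card_univ, ← Finset.card_erase_of_mem (Finset.mem_univ φ)]
    rw [← Finset.prod_const]
    refine Finset.prod_le_prod (fun _ _ => norm_nonneg _) fun σ _ => ?_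
    rw [hterm]
    exact mul_le_mul_of_nonneg_left (hσ σ) (abs_nonneg _)
  have hcard : Fintype.card (K →ₐ[ℚ] ℂ) = (Fintype.card (K →ₐ[ℚ] ℂ) - 1) + 1 :=
    (Nat.succ_pred_eq_of_pos (Fintype.card_pos_iff.2 ⟨φ⟩)).symm
  calc (1 : ℝ) ≤ |(a : ℝ)| := by exact_mod_cast Int.one_le_abs ha0
    _ = ‖φ ((D : K) * ξ)‖ * ∏ σ ∈ Finset.univ.erase φ, ‖σ ((D : K) * ξ)‖ := by
      rw [← hprod, Finset.mul_prod_erase _ (fun σ : K →ₐ[ℚ] ℂ => ‖σ ((D : K) * ξ)‖)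
        (Finset.mem_univ φ)]
    _ ≤ (|(D : ℝ)| * ‖φ ξ‖) * (|(D : ℝ)| * B) ^ (Fintype.card (K →ₐ[ℚ] ℂ) - 1) := by
      rw [hterm]; gcongr
    _ ≤ (|(D : ℝ)| * B * ‖φ ξ‖) * (|(D : ℝ)| * B) ^ (Fintype.card (K →ₐ[ℚ] ℂ) - 1) := by
      gcongr
      exact le_mul_of_one_le_right (by positivity) hB
    _ = _ := by
      conv_rhs => rw [hcard, pow_succ]
      ring

/-! ### The auxiliary polynomial -/

/-- The bivariate polynomial `∑ p (i, j) * z ^ i * w ^ j`, with `w` the outer variable. -/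
noncomputable def bivariate {N : ℕ} (p : Fin (N + 1) × Fin (N + 1) → ℤ) : ℂ[X][X] :=
  ∑ ij, Polynomial.monomial (ij.2 : ℕ) (Polynomial.monomial (ij.1 : ℕ) (p ij : ℂ))

theorem bivariate_ne_zero {N : ℕ} {p : Fin (N + 1) × Fin (N + 1) → ℤ} (hp : p ≠ 0) :
    bivariate p ≠ 0 := by
  obtain ⟨⟨i, j⟩, hij⟩ := Function.ne_iff.1 hp
  intro h
  have h1 : ((bivariate p).coeff (j : ℕ)).coeff (i : ℕ) = (p (i, j) : ℂ) := by
    rw [bivariate, Polynomial.finsetSum_coeff, Polynomial.finsetSum_coeff,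
      Finset.sum_eq_single (i, j)]
    · simp
    · rintro ⟨a, b⟩ - hab
      rw [Polynomial.coeff_monomial]
      split_ifs with hb
      · rw [Polynomial.coeff_monomial, if_neg]
        intro ha
        exact hab (Prod.ext (Fin.ext ha) (Fin.ext hb))
      · simp
    · simp
  rw [h] at h1
  exact hij (by simpa using h1.symm)

theorem evalEval_bivariate {N : ℕ} (p : Fin (N + 1) × Fin (N + 1) → ℤ) (z w : ℂ) :
    (bivariate p).evalEval z w = ∑ ij, (p ij : ℂ) * z ^ (ij.1 : ℕ) * w ^ (ij.2 : ℕ) := by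
  rw [bivariate, Polynomial.evalEval_finsetSum]
  refine Finset.sum_congr rfl fun ij _ => ?_
  simp [Polynomial.evalEval, ← Polynomial.C_mul_X_pow_eq_monomial]

/-- The formal series with integer coefficients. -/
noncomputable def liouvilleMod3IntSeries : ℤ⟦X⟧ := PowerSeries.mk fun n => liouvilleMod3 n

theorem map_liouvilleMod3IntSeries :
    PowerSeries.map (Int.castRingHom ℂ) liouvilleMod3IntSeries = liouvilleMod3Series := by
  ext n
  simp [liouvilleMod3IntSeries, liouvilleMod3Series]

/-- There are more coefficients, `(N + 1) ^ 2`, than conditions, `N ^ 2`. -/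
theorem exists_bivariate_coeff_eq_zero {N : ℕ} (hN : 0 < N) :
    ∃ p : Fin (N + 1) × Fin (N + 1) → ℤ, p ≠ 0 ∧ ∀ n < N ^ 2,
      PowerSeries.coeff n (Polynomial.aeval liouvilleMod3Series (bivariate p)) = 0 := by
  let A : Matrix (Fin (N ^ 2)) (Fin (N + 1) × Fin (N + 1)) ℤ := Matrix.of fun n ij =>
    PowerSeries.coeff (n : ℕ)
      ((PowerSeries.X : ℤ⟦X⟧) ^ (ij.1 : ℕ) * liouvilleMod3IntSeries ^ (ij.2 : ℕ))
  obtain ⟨p, hp, hAp, -⟩ := Int.Matrix.exists_ne_zero_int_vec_norm_le A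
    (by simp only [Fintype.card_fin, Fintype.card_prod]; nlinarith)
    (by simp only [Fintype.card_fin]; positivity)
  refine ⟨p, hp, fun n hn => ?_⟩
  have h := congrFun hAp ⟨n, hn⟩
  have hmap : Polynomial.aeval liouvilleMod3Series (bivariate p) =
      PowerSeries.map (Int.castRingHom ℂ) (∑ ij, PowerSeries.C (p ij) *
        ((PowerSeries.X : ℤ⟦X⟧) ^ (ij.1 : ℕ) * liouvilleMod3IntSeries ^ (ij.2 : ℕ))) := by
    rw [bivariate, map_sum, map_sum]
    refine Finset.sum_congr rfl fun ij _ => ?_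
    rw [Polynomial.aeval_monomial, PowerSeries.algebraMap_apply', map_mul, map_mul, map_pow,
      map_pow, map_liouvilleMod3IntSeries, ← Polynomial.C_mul_X_pow_eq_monomial]
    simp only [Polynomial.coe_mul, Polynomial.coe_C, Polynomial.coe_pow, Polynomial.coe_X,
      PowerSeries.map_C, PowerSeries.map_X, map_mul, map_pow, Algebra.algebraMap_self,
      RingHom.id_apply, Int.coe_castRingHom, mul_assoc]
  rw [hmap, PowerSeries.coeff_map, map_sum]
  have h0 : ∑ ij, PowerSeries.coeff n (PowerSeries.C (p ij) *
      ((PowerSeries.X : ℤ⟦X⟧) ^ (ij.1 : ℕ) * liouvilleMod3IntSeries ^ (ij.2 : ℕ))) = 0 := by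
    rw [← h.trans (Pi.zero_apply _), Matrix.mulVec, dotProduct]
    refine Finset.sum_congr rfl fun ij _ => ?_
    rw [PowerSeries.coeff_C_mul, mul_comm]
    rfl
  rw [h0, map_zero]

/-! ### Values of the auxiliary polynomial along the orbit of `z ↦ z ^ 3` -/

/-- The polynomial in `x = z` and `y = T z` obtained from `∑ p (i, j) * (z ^ m) ^ i * T (z ^ m) ^ j`
for `m = 3 ^ k` by substituting the functional equation and clearing the denominator
`(1 - z ^ m) ^ N`. -/
def orbitValue {R : Type*} [CommRing R] {N : ℕ} (p : Fin (N + 1) × Fin (N + 1) → ℤ) (m : ℕ)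
    (x y : R) : R :=
  ∑ ij, (p ij : R) * (x ^ m) ^ (ij.1 : ℕ) *
    ((1 - x ^ m) * y - liouvilleMod3Trunc m x) ^ (ij.2 : ℕ) * (1 - x ^ m) ^ (N - (ij.2 : ℕ))

theorem map_liouvilleMod3Trunc {R S : Type*} [CommRing R] [CommRing S] (φ : R →+* S) (m : ℕ)
    (x : R) : φ (liouvilleMod3Trunc m x) = liouvilleMod3Trunc m (φ x) := by
  simp [liouvilleMod3Trunc]

theorem map_orbitValue {R S : Type*} [CommRing R] [CommRing S] (φ : R →+* S) {N : ℕ}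
    (p : Fin (N + 1) × Fin (N + 1) → ℤ) (m : ℕ) (x y : R) :
    φ (orbitValue p m x y) = orbitValue p m (φ x) (φ y) := by
  simp [orbitValue, map_liouvilleMod3Trunc]

theorem orbitValue_liouvilleMod3Gen {N : ℕ} (p : Fin (N + 1) × Fin (N + 1) → ℤ) (k : ℕ) {z : ℂ}
    (hz : ‖z‖ < 1) :
    orbitValue p (3 ^ k) z (liouvilleMod3Gen z) =
      (1 - z ^ 3 ^ k) ^ N *
        (bivariate p).evalEval (z ^ 3 ^ k) (liouvilleMod3Gen (z ^ 3 ^ k)) := by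
  have h1 := one_sub_ne_zero_of_norm_lt (norm_pow_three_pow_lt hz k)
  have h : (1 - z ^ 3 ^ k) * liouvilleMod3Gen z - liouvilleMod3Trunc (3 ^ k) z =
      (1 - z ^ 3 ^ k) * liouvilleMod3Gen (z ^ 3 ^ k) := by
    rw [liouvilleMod3Gen_eq k hz]
    field_simp
    ring
  rw [orbitValue, evalEval_bivariate, Finset.mul_sum]
  refine Finset.sum_congr rfl fun ij _ => ?_
  have hpow : (1 - z ^ 3 ^ k) ^ N =
      (1 - z ^ 3 ^ k) ^ (ij.2 : ℕ) * (1 - z ^ 3 ^ k) ^ (N - (ij.2 : ℕ)) := by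
    rw [← pow_add, Nat.add_sub_of_le (Nat.lt_succ_iff.1 ij.2.2)]
  rw [h, hpow, mul_pow]
  ring

theorem add_two_le_three_pow {m : ℕ} (hm : 0 < m) : m + 2 ≤ 3 ^ m := by
  induction m, hm using Nat.le_induction with
  | base => norm_num
  | succ n _ ih => rw [pow_succ]; omega

/-- The bound for the conjugates in the Liouville inequality: exponential in `m * N`, with a base
independent of `m`, `N` and `p`. -/
theorem norm_orbitValue_le {N : ℕ} (p : Fin (N + 1) × Fin (N + 1) → ℤ) {m : ℕ} (hm : 0 < m)
    {x y : ℂ} {M : ℝ} (hM : 1 ≤ M) (hx : ‖x‖ ≤ M) (hy : ‖y‖ ≤ M) :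
    ‖orbitValue p m x y‖ ≤ (∑ ij, |(p ij : ℝ)|) * (3 * M ^ 3) ^ (m * N) := by
  have hxm : ‖x ^ m‖ ≤ M ^ m := by rw [norm_pow]; gcongr
  have hMm : 1 ≤ M ^ m := one_le_pow₀ hM
  have h3 : (m : ℝ) + 2 ≤ 3 ^ m := by exact_mod_cast add_two_le_three_pow hm
  have hE : ‖1 - x ^ m‖ ≤ 2 * M ^ m := by
    refine (norm_sub_le _ _).trans ?_
    rw [norm_one]; linarith
  have hMM : M ^ m * M ≤ (M ^ 2) ^ m := by
    rw [← pow_mul, ← pow_succ]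
    exact pow_le_pow_right₀ hM (by omega)
  have hMm2 : M ^ m ≤ (M ^ 2) ^ m := by
    rw [← pow_mul]
    exact pow_le_pow_right₀ hM (by omega)
  have hE' : ‖1 - x ^ m‖ ≤ (3 * M ^ 2) ^ m := by
    rw [mul_pow]
    refine hE.trans ?_
    gcongr
    linarith [(Nat.cast_nonneg m : (0 : ℝ) ≤ m)]
  have hA : ‖liouvilleMod3Trunc m x‖ ≤ m * M ^ m := by
    have h := norm_sum_le_of_le (Finset.range m) (f := fun n => (liouvilleMod3 n : ℂ) * x ^ n)
      (n := fun _ => M ^ m) fun n hn => by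
        rw [norm_mul, norm_pow]
        calc ‖(liouvilleMod3 n : ℂ)‖ * ‖x‖ ^ n ≤ 1 * M ^ n := by
              gcongr; exact norm_liouvilleMod3_le n
          _ ≤ M ^ m := by
              rw [one_mul]; exact pow_le_pow_right₀ hM (Finset.mem_range.1 hn).le
    simpa [liouvilleMod3Trunc] using h
  have hF : ‖(1 - x ^ m) * y - liouvilleMod3Trunc m x‖ ≤ (3 * M ^ 2) ^ m := by
    calc ‖(1 - x ^ m) * y - liouvilleMod3Trunc m x‖
        ≤ ‖1 - x ^ m‖ * ‖y‖ + ‖liouvilleMod3Trunc m x‖ := by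
          rw [← norm_mul]; exact norm_sub_le _ _
      _ ≤ 2 * M ^ m * M + m * M ^ m := by gcongr
      _ ≤ 2 * (M ^ 2) ^ m + m * (M ^ 2) ^ m := by rw [mul_assoc]; gcongr
      _ = (m + 2) * (M ^ 2) ^ m := by ring
      _ ≤ 3 ^ m * (M ^ 2) ^ m := by gcongr
      _ = _ := by rw [mul_pow]
  rw [orbitValue, Finset.sum_mul]
  refine norm_sum_le_of_le _ fun ij _ => ?_
  have hi : (ij.1 : ℕ) ≤ N := Nat.lt_succ_iff.1 ij.1.2
  have hj : (ij.2 : ℕ) ≤ N := Nat.lt_succ_iff.1 ij.2.2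
  rw [norm_mul, norm_mul, norm_mul, norm_pow _ (ij.1 : ℕ), norm_pow _ (ij.2 : ℕ),
    norm_pow _ (N - (ij.2 : ℕ)), Complex.norm_intCast]
  calc |(p ij : ℝ)| * ‖x ^ m‖ ^ (ij.1 : ℕ) *
        ‖(1 - x ^ m) * y - liouvilleMod3Trunc m x‖ ^ (ij.2 : ℕ) *
        ‖1 - x ^ m‖ ^ (N - (ij.2 : ℕ))
      ≤ |(p ij : ℝ)| * (M ^ m) ^ (ij.1 : ℕ) * ((3 * M ^ 2) ^ m) ^ (ij.2 : ℕ) *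
        ((3 * M ^ 2) ^ m) ^ (N - (ij.2 : ℕ)) := by gcongr
    _ ≤ |(p ij : ℝ)| * (M ^ m) ^ N * ((3 * M ^ 2) ^ m) ^ (ij.2 : ℕ) *
        ((3 * M ^ 2) ^ m) ^ (N - (ij.2 : ℕ)) := by gcongr
    _ = |(p ij : ℝ)| * (M ^ m) ^ N * ((3 * M ^ 2) ^ m) ^ N := by
        rw [mul_assoc, ← pow_add, Nat.add_sub_of_le hj]
    _ = |(p ij : ℝ)| * (3 * M ^ 3) ^ (m * N) := by
        rw [mul_assoc, ← mul_pow, ← mul_pow, ← pow_mul]; ring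

/-- The bound for the denominator in the Liouville inequality. -/
theorem isIntegral_orbitValue {K : Type*} [Field K] {N : ℕ}
    (p : Fin (N + 1) × Fin (N + 1) → ℤ) {m : ℕ} (hm : 0 < m) {x y : K} {D : ℤ}
    (hx : IsIntegral ℤ ((D : K) * x)) (hy : IsIntegral ℤ ((D : K) * y)) :
    IsIntegral ℤ (((D ^ (3 * m * N) : ℤ) : K) * orbitValue p m x y) := by
  have hz : ∀ a : ℤ, IsIntegral ℤ (a : K) := fun a => isIntegral_algebraMap (R := ℤ) (x := a)
  have hDp : ∀ n : ℕ, IsIntegral ℤ ((D : K) ^ n) := fun n => (hz D).pow n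
  have hE : IsIntegral ℤ ((D : K) ^ m * (1 - x ^ m)) := by
    have : (D : K) ^ m * (1 - x ^ m) = (D : K) ^ m - ((D : K) * x) ^ m := by ring
    rw [this]
    exact (hDp m).sub (hx.pow m)
  have hE' : IsIntegral ℤ ((D : K) ^ (2 * m) * (1 - x ^ m)) := by
    have : (D : K) ^ (2 * m) * (1 - x ^ m) = (D : K) ^ m * ((D : K) ^ m * (1 - x ^ m)) := by ring
    rw [this]
    exact (hDp m).mul hE
  have hA : IsIntegral ℤ ((D : K) ^ (2 * m) * liouvilleMod3Trunc m x) := by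
    rw [liouvilleMod3Trunc, Finset.mul_sum]
    refine IsIntegral.sum _ fun n hn => ?_
    have hn' : n ≤ 2 * m := by have := Finset.mem_range.1 hn; omega
    have : (D : K) ^ (2 * m) * ((liouvilleMod3 n : K) * x ^ n) =
        (liouvilleMod3 n : K) * (D : K) ^ (2 * m - n) * ((D : K) * x) ^ n := by
      conv_lhs => rw [← Nat.sub_add_cancel hn', pow_add]
      rw [mul_pow]; ring
    rw [this]
    exact ((hz _).mul (hDp _)).mul (hx.pow n)
  have hF : IsIntegral ℤ ((D : K) ^ (2 * m) * ((1 - x ^ m) * y - liouvilleMod3Trunc m x)) := by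
    obtain ⟨n, rfl⟩ : ∃ n, m = n + 1 := Nat.exists_eq_succ_of_ne_zero hm.ne'
    have : (D : K) ^ (2 * (n + 1)) * ((1 - x ^ (n + 1)) * y - liouvilleMod3Trunc (n + 1) x) =
        (D : K) ^ n * ((D : K) ^ (n + 1) * (1 - x ^ (n + 1))) * ((D : K) * y) -
          (D : K) ^ (2 * (n + 1)) * liouvilleMod3Trunc (n + 1) x := by ring
    rw [this]
    exact (((hDp n).mul hE).mul hy).sub hA
  rw [orbitValue, Finset.mul_sum]
  refine IsIntegral.sum _ fun ij _ => ?_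
  have hi : (ij.1 : ℕ) ≤ N := Nat.lt_succ_iff.1 ij.1.2
  have hj : (ij.2 : ℕ) ≤ N := Nat.lt_succ_iff.1 ij.2.2
  obtain ⟨a, ha⟩ := Nat.exists_eq_add_of_le hi
  obtain ⟨b, hb⟩ := Nat.exists_eq_add_of_le hj
  have hpow : (D : K) ^ (3 * m * N) = (D : K) ^ (m * a) * ((D : K) ^ m) ^ (ij.1 : ℕ) *
      ((D : K) ^ (2 * m)) ^ (ij.2 : ℕ) * ((D : K) ^ (2 * m)) ^ b := by
    rw [← pow_mul, ← pow_mul, ← pow_mul, ← pow_add, ← pow_add, ← pow_add]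
    congr 1
    calc 3 * m * N = m * N + 2 * m * N := by ring
      _ = m * (ij.1 + a) + 2 * m * (ij.2 + b) := by rw [← ha, ← hb]
      _ = _ := by ring
  have hb' : N - (ij.2 : ℕ) = b := by omega
  have hterm : ((D ^ (3 * m * N) : ℤ) : K) * ((p ij : K) * (x ^ m) ^ (ij.1 : ℕ) *
      ((1 - x ^ m) * y - liouvilleMod3Trunc m x) ^ (ij.2 : ℕ) *
        (1 - x ^ m) ^ (N - (ij.2 : ℕ))) =
      (p ij : K) * (D : K) ^ (m * a) * (((D : K) * x) ^ m) ^ (ij.1 : ℕ) *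
        ((D : K) ^ (2 * m) * ((1 - x ^ m) * y - liouvilleMod3Trunc m x)) ^ (ij.2 : ℕ) *
          ((D : K) ^ (2 * m) * (1 - x ^ m)) ^ b := by
    rw [hb']
    push_cast
    rw [hpow, mul_pow (D : K) x, mul_pow ((D : K) ^ m), mul_pow ((D : K) ^ (2 * m)),
      mul_pow ((D : K) ^ (2 * m))]
    ring
  rw [hterm]
  exact ((((hz _).mul (hDp _)).mul ((hx.pow m).pow _)).mul (hF.pow _)).mul (hE'.pow _)

/-! ### Transcendence of the values -/

/-- Two algebraic numbers lie in a common number field and have there a common denominator. -/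
theorem exists_numberField_of_isAlgebraic {α θ : ℂ} (hα : IsAlgebraic ℚ α)
    (hθ : IsAlgebraic ℚ θ) :
    ∃ (K : IntermediateField ℚ ℂ) (_ : NumberField K) (x y : K) (D : ℤ), (x : ℂ) = α ∧
      (y : ℂ) = θ ∧ D ≠ 0 ∧ IsIntegral ℤ ((D : K) * x) ∧ IsIntegral ℤ ((D : K) * y) := by
  let K : IntermediateField ℚ ℂ := IntermediateField.adjoin ℚ {α, θ}
  have hfin : FiniteDimensional ℚ K := by
    refine IntermediateField.finiteDimensional_adjoin fun x hx => ?_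
    rcases hx with rfl | rfl
    · exact hα.isIntegral
    · exact hθ.isIntegral
  have hK : NumberField K := { to_charZero := inferInstance, to_finiteDimensional := hfin }
  have hx : α ∈ K := IntermediateField.subset_adjoin _ _ (by simp)
  have hy : θ ∈ K := IntermediateField.subset_adjoin _ _ (by simp)
  classical
  obtain ⟨D, hD, hint⟩ := exists_integral_multiples ℤ ℚ (L := K) {⟨α, hx⟩, ⟨θ, hy⟩}
  refine ⟨K, hK, ⟨α, hx⟩, ⟨θ, hy⟩, D, rfl, rfl, hD, ?_, ?_⟩
  · simpa only [zsmul_eq_mul] using hint ⟨α, hx⟩ (by simp)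
  · simpa only [zsmul_eq_mul] using hint ⟨θ, hy⟩ (by simp)

/-- Mahler's method: if `α` and `T α` were both algebraic, the auxiliary polynomial would take
values at the points `(α ^ 3 ^ k, T (α ^ 3 ^ k))` that are nonzero but smaller than the Liouville
inequality permits. -/
theorem transcendental_liouvilleMod3Gen {α : ℂ} (hα : IsAlgebraic ℚ α) (hα0 : α ≠ 0)
    (hα1 : ‖α‖ < 1) : Transcendental ℚ (liouvilleMod3Gen α) := by
  intro hθ
  obtain ⟨K, _, x, y, D, hx, hy, hD, hxint, hyint⟩ := exists_numberField_of_isAlgebraic hα hθ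
  set d := Fintype.card (K →ₐ[ℚ] ℂ) with hd
  have hα' : 0 < ‖α‖ := norm_pos_iff.2 hα0
  -- a bound for all conjugates of `α` and `T α`
  obtain ⟨M, hM1, hM⟩ : ∃ M : ℝ, 1 ≤ M ∧ ∀ σ : K →ₐ[ℚ] ℂ, ‖σ x‖ ≤ M ∧ ‖σ y‖ ≤ M := by
    refine ⟨1 + ∑ σ : K →ₐ[ℚ] ℂ, (‖σ x‖ + ‖σ y‖), ?_, fun σ => ?_⟩
    · have : 0 ≤ ∑ σ : K →ₐ[ℚ] ℂ, (‖σ x‖ + ‖σ y‖) := by positivity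
      linarith
    · have h := Finset.single_le_sum (f := fun σ : K →ₐ[ℚ] ℂ => ‖σ x‖ + ‖σ y‖)
        (fun _ _ => by positivity) (Finset.mem_univ σ)
      have := norm_nonneg (σ x)
      have := norm_nonneg (σ y)
      constructor <;> linarith
  -- with `m = 3 ^ k`, the Liouville inequality loses a factor `G ^ (m * N)`, and the order of
  -- vanishing gains a factor `‖α‖ ^ (m * N ^ 2)`; `N` is chosen to make the gain win
  set G : ℝ := (|(D : ℝ)| ^ 3 * (3 * M ^ 3)) ^ d with hG
  obtain ⟨N, hN0, hN⟩ : ∃ N : ℕ, 0 < N ∧ ‖α‖ ^ N * G < 1 := by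
    have h := (tendsto_pow_atTop_nhds_zero_of_lt_one hα'.le hα1).mul_const G
    rw [zero_mul] at h
    obtain ⟨N, h1, h2⟩ := ((h.eventually (gt_mem_nhds one_pos)).and (eventually_gt_atTop 0)).exists
    exact ⟨N, h2, h1⟩
  obtain ⟨p, hp, hcoeff⟩ := exists_bivariate_coeff_eq_zero hN0
  have hsum := hasDiscSum_liouvilleMod3.aeval (bivariate p)
  obtain ⟨ε, hε, hne⟩ := hsum.exists_forall_ne_zero
    (aeval_liouvilleMod3Series_ne_zero (bivariate_ne_zero hp))
  obtain ⟨H, hH, hfac⟩ := hsum.exists_shift (N ^ 2) hcoeff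
  obtain ⟨C, hC0, hC⟩ := hH.exists_bound hα'.le hα1
  set L : ℝ := 1 + ∑ ij, |(p ij : ℝ)| with hL
  have hL1 : 1 ≤ L := by
    have : 0 ≤ ∑ ij, |(p ij : ℝ)| := by positivity
    linarith
  -- the Liouville inequality at `α ^ 3 ^ k`, for large `k`
  have key : ∀ k : ℕ, ‖α ^ 3 ^ k‖ < ε →
      1 ≤ 2 ^ N * C * L ^ d * ((‖α‖ ^ N * G) ^ N) ^ 3 ^ k := by
    intro k hk
    have hm : 0 < 3 ^ k := by positivity
    have hβ := norm_pow_three_pow_lt hα1 k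
    have hval : ((orbitValue p (3 ^ k) x y : K) : ℂ) = (1 - α ^ 3 ^ k) ^ N *
        (bivariate p).evalEval (α ^ 3 ^ k) (liouvilleMod3Gen (α ^ 3 ^ k)) := by
      rw [← orbitValue_liouvilleMod3Gen p k hα1]
      have h := map_orbitValue (algebraMap K ℂ) p (3 ^ k) x y
      rw [show algebraMap K ℂ x = α from hx, show algebraMap K ℂ y = liouvilleMod3Gen α from hy]
        at h
      exact h
    have hξ : orbitValue p (3 ^ k) x y ≠ 0 := by
      intro h0
      rw [h0] at hval
      exact mul_ne_zero (pow_ne_zero _ (one_sub_ne_zero_of_norm_lt hβ))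
        (hne _ (pow_ne_zero _ hα0) hk) hval.symm
    have hnorm : ‖((orbitValue p (3 ^ k) x y : K) : ℂ)‖ ≤
        2 ^ N * ((‖α‖ ^ 3 ^ k) ^ N ^ 2 * C) := by
      rw [hval, hfac _ hβ, norm_mul, norm_mul, norm_pow, norm_pow, norm_pow]
      have h2 : ‖1 - α ^ 3 ^ k‖ ≤ 2 := by
        refine (norm_sub_le _ _).trans ?_
        rw [norm_one]; linarith
      have hle : ‖α ^ 3 ^ k‖ ≤ ‖α‖ := by
        rw [norm_pow]; exact pow_le_of_le_one hα'.le hα1.le hm.ne'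
      gcongr
      exact hC _ hle
    have hM3 : 1 ≤ 3 * M ^ 3 := by
      have : 1 ≤ M ^ 3 := one_le_pow₀ hM1
      linarith
    have h1 := one_le_norm_mul_pow K.val hξ (D := D ^ (3 * 3 ^ k * N)) (pow_ne_zero _ hD)
      (isIntegral_orbitValue p hm hxint hyint) (B := L * (3 * M ^ 3) ^ (3 ^ k * N))
      (one_le_mul_of_one_le_of_one_le hL1 (one_le_pow₀ hM3)) fun σ => by
        have hσ := map_orbitValue (σ : K →+* ℂ) p (3 ^ k) x y
        rw [RingHom.coe_coe] at hσ
        rw [hσ]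
        refine (norm_orbitValue_le p hm hM1 (hM σ).1 (hM σ).2).trans ?_
        gcongr
        linarith
    have hloss : (|(D : ℝ)| ^ (3 * 3 ^ k * N) * (L * (3 * M ^ 3) ^ (3 ^ k * N))) ^ d =
        L ^ d * G ^ (3 ^ k * N) := by
      rw [mul_assoc 3 (3 ^ k) N, pow_mul |(D : ℝ)| 3, mul_left_comm, ← mul_pow, mul_pow L, hG,
        ← pow_mul, ← pow_mul, mul_comm d]
    refine h1.trans ?_
    rw [← hd]
    push_cast
    rw [abs_pow]
    calc ‖K.val (orbitValue p (3 ^ k) x y)‖ *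
          (|(D : ℝ)| ^ (3 * 3 ^ k * N) * (L * (3 * M ^ 3) ^ (3 ^ k * N))) ^ d
        ≤ (2 ^ N * ((‖α‖ ^ 3 ^ k) ^ N ^ 2 * C)) *
          (|(D : ℝ)| ^ (3 * 3 ^ k * N) * (L * (3 * M ^ 3) ^ (3 ^ k * N))) ^ d := by
          gcongr
          exact hnorm
      _ = 2 ^ N * C * L ^ d * ((‖α‖ ^ 3 ^ k) ^ N ^ 2 * G ^ (3 ^ k * N)) := by
          rw [hloss]; ring
      _ = 2 ^ N * C * L ^ d * ((‖α‖ ^ N * G) ^ N) ^ 3 ^ k := by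
          clear_value G
          generalize 3 ^ k = m
          ring
  have hβ0 : Tendsto (fun k : ℕ => ‖α ^ 3 ^ k‖) atTop (𝓝 0) := by
    simp_rw [norm_pow]
    exact (tendsto_pow_atTop_nhds_zero_of_lt_one hα'.le hα1).comp tendsto_three_pow_atTop
  have hlim : Tendsto (fun k : ℕ => 2 ^ N * C * L ^ d * ((‖α‖ ^ N * G) ^ N) ^ 3 ^ k)
      atTop (𝓝 0) := by
    have h := (tendsto_pow_atTop_nhds_zero_of_lt_one (r := (‖α‖ ^ N * G) ^ N) (by positivity)
      (pow_lt_one₀ (by positivity) hN hN0.ne')).comp tendsto_three_pow_atTop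
    simpa only [mul_zero, Function.comp_def] using h.const_mul (2 ^ N * C * L ^ d)
  obtain ⟨k, hk1, hk2⟩ := ((hβ0.eventually (gt_mem_nhds hε)).and
    (hlim.eventually (gt_mem_nhds one_pos))).exists
  exact absurd (key k hk1) (not_le.2 hk2)

theorem mainTheorem5 :
    -- the generating function converges in the open unit disc and has the closed form there
    (∀ z : ℂ, ‖z‖ < 1 →
      HasSum (fun n : ℕ => (liouvilleMod3 n : ℂ) * z ^ n) (liouvilleMod3Gen z) ∧
      HasSum (fun k : ℕ => z ^ 3 ^ k / (1 + z ^ 3 ^ k + z ^ (2 * 3 ^ k)))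
        (liouvilleMod3Gen z)) ∧
    -- it is transcendental over `ℂ(z)`, as a formal series
    Transcendental (RatFunc ℂ) (A := LaurentSeries ℂ) (liouvilleMod3Series : LaurentSeries ℂ) ∧
    -- and as a function on the open unit disc: no nonzero polynomial relation `P(z, T(z)) = 0`
    (∀ P : Polynomial (Polynomial ℂ), P ≠ 0 →
      ∃ z : ℂ, ‖z‖ < 1 ∧ P.evalEval z (liouvilleMod3Gen z) ≠ 0) ∧
    -- its values at nonzero algebraic points of the open unit disc are transcendental numbers
    (∀ α : ℂ, IsAlgebraic ℚ α → α ≠ 0 → ‖α‖ < 1 →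
      Transcendental ℚ (liouvilleMod3Gen α)) :=
  ⟨fun _ hz => ⟨(summable_norm_liouvilleMod3 hz).of_norm.hasSum,
      hasSum_liouvilleMod3Gen_closed hz⟩,
    transcendental_liouvilleMod3Series,
    fun _ hP => exists_evalEval_liouvilleMod3Gen_ne_zero hP,
    fun _ hα hα0 hα1 => transcendental_liouvilleMod3Gen hα hα0 hα1⟩
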